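/- **Theorem.** Work in the category of pointed topological spaces and base-point-preserving continuous maps, with homotopies relative to the base point. For a pointed space $(A,*)$ let $\mathrm{C}A = A\times I/(A\times\{0\}\cup\{*\}\times I)$ be its reduced cone, containing $A$ as the image of $A\times\{1\}$, let $\Sigma A = A\times I/(A\times\{0,1\}\cup\{*\}\times I)$ be its reduced suspension, let $\Sigma^0A=A$ and $\Sigma^{n}A=\Sigma(\Sigma^{n-1}A)$, and let $\pi_n^A(X)=[\Sigma^nA,X]$ be the set of pointed homotopy classes of maps $\Sigma^nA\to X$, $n\ge 0$. A map $f:X\to Y$ is an *$A$-weak equivalence* if $f_*:\pi_n^A(X)\to\pi_n^A(Y)$ is an isomorphism (bijective) for every $n\ge 0$. A space $X$ *is obtained from $B$ by attaching $A$-cells* if there are sets $J_0,J$, integers $n_\alpha\ge 1$ and maps $g_\alpha:\Sigma^{n_\alpha-1}A\to B$ ($\alpha\in J$) and a pushout square $$\begin{array}{ccc}\bigvee_{\alpha\in J}\Sigma^{n_\alpha-1}A & \xrightarrow{\ +g_\alpha\ } & B\\ \downarrow & & \downarrow\\ \bigl(\bigvee_{J_0}A\bigr)\vee\bigl(\bigvee_{\alpha\in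 J}\mathrm{C}\Sigma^{n_\alpha-1}A\bigr) & \longrightarrow & X\end{array}$$ whose left vertical map is induced by the inclusions $\Sigma^{n_\alpha-1}A\hookrightarrow\mathrm{C}\Sigma^{n_\alpha-1}A$. A *generalized CW($A$)-complex* is a colimit of a sequence $*=X^0\to X^1\to X^2\to\cdots$ in which each $X^n$ ($n\ge1$) is obtained from $X^{n-1}$ by attaching $A$-cells, through the map of the sequence. An *H-cogroup* is a pointed space $A$ that admits a comultiplication $A\to A\vee A$ and an inverse $A\to A$ that satisfy, up to pointed homotopy, coassociativity, the two-sided counit axiom (the counit being the constant map) and the two-sided inverse axiom. Let $A$ be an H-cogroup whose underlying space is compact (not necessarily Hausdorff) and $T_1$. Then for every pointed topological space $X$ there exist a generalized CW($A$)-complex $Z$ and an $A$-weak equivalence $f:Z\to X$. -/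

import Mathlib

open CategoryTheory CategoryTheory.Limits

universe u

/-- A pointed topological space. -/
structure PtdTop : Type (u + 1) where
  carrier : Type u
  [top : TopologicalSpace carrier]
  pt : carrier

namespace PtdTop

instance : CoeSort PtdTop.{u} (Type u) := ⟨PtdTop.carrier⟩

instance (X : PtdTop.{u}) : TopologicalSpace X := X.top

/-- Continuous maps preserving the base points. -/
@[ext]
structure Hom (X Y : PtdTop.{u}) where
  toCont : C(X, Y)
  map_pt : toCont X.pt = Y.pt

/-- The category of pointed topological spaces and base point preserving continuous maps. -/
instance : Category PtdTop.{u} where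
  Hom X Y := Hom X Y
  id X := ⟨ContinuousMap.id X, rfl⟩
  comp f g := ⟨g.toCont.comp f.toCont, by simp [f.map_pt, g.map_pt]⟩

/-- The constant map at the base point. -/
def const (X Y : PtdTop.{u}) : X ⟶ Y := Hom.mk (ContinuousMap.const X Y.pt) rfl

/-! ### Pointed homotopy -/

/-- Homotopy relative to the base point. -/
def Homotopic {X Y : PtdTop.{u}} (f g : X ⟶ Y) : Prop :=
  ContinuousMap.HomotopicRel (Hom.toCont f) (Hom.toCont g) {X.pt}

/-- Pointed homotopy as an equivalence relation on pointed maps. -/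
def homotopySetoid (X Y : PtdTop.{u}) : Setoid (X ⟶ Y) where
  r := Homotopic
  iseqv :=
    { refl := fun f => ContinuousMap.HomotopicRel.refl (Hom.toCont f)
      symm := fun h => ContinuousMap.HomotopicRel.symm h
      trans := fun h k => ContinuousMap.HomotopicRel.trans h k }

/-- The set `[X, Y]` of pointed homotopy classes of pointed maps. -/
def HomotopyClasses (X Y : PtdTop.{u}) : Type u := Quotient (homotopySetoid X Y)

theorem Homotopic.postcomp {W X Y : PtdTop.{u}} {g h : W ⟶ X} (H : Homotopic g h)
    (f : X ⟶ Y) : Homotopic (g ≫ f) (h ≫ f) :=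
  ContinuousMap.HomotopicRel.comp_continuousMap H (Hom.toCont f)

/-- The map `f_* : [W, X] → [W, Y]`, `[g] ↦ [f ∘ g]`. -/
def HomotopyClasses.map (W : PtdTop.{u}) {X Y : PtdTop.{u}} (f : X ⟶ Y) :
    HomotopyClasses W X → HomotopyClasses W Y :=
  Quotient.map' (s₁ := homotopySetoid W X) (s₂ := homotopySetoid W Y)
    (fun g => g ≫ f) (fun _ _ H => Homotopic.postcomp H f)

/-! ### Quotients, cones, suspensions, wedges -/

/-- The equivalence relation on `X` identifying all points of `S` with each other. -/
def collapseSetoid {X : Type u} (S : Set X) : Setoid X where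
  r x y := x = y ∨ (x ∈ S ∧ y ∈ S)
  iseqv :=
    { refl := fun _ => Or.inl rfl
      symm := by rintro x y (rfl | ⟨h, k⟩) <;> tauto
      trans := by rintro x y z (rfl | ⟨h, k⟩) (rfl | ⟨h', k'⟩) <;> tauto }

/-- The quotient space `X / S`, pointed by the class of `x₀`; it is used with `x₀ ∈ S` only. -/
def collapse (X : Type u) [TopologicalSpace X] (S : Set X) (x₀ : X) : PtdTop.{u} where
  carrier := Quotient (collapseSetoid S)
  top := inferInstance
  pt := Quotient.mk _ x₀

/-- A continuous map which is constant on `S`, with value the base point, descends to `X / S`. -/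
def collapseDesc {X : Type u} [TopologicalSpace X] {S : Set X} {x₀ : X} {Y : PtdTop.{u}}
    (f : C(X, Y)) (hf : ∀ x ∈ S, f x = Y.pt) (h₀ : x₀ ∈ S) : collapse X S x₀ ⟶ Y :=
  Hom.mk
    ⟨Quotient.lift (s := collapseSetoid S) f (by
        rintro x y (rfl | ⟨h, k⟩)
        · rfl
        · rw [hf x h, hf y k]),
      f.continuous.quotient_lift _⟩
    (hf x₀ h₀)

/-- The reduced cone `C X = X × I / (X × {0} ∪ {*} × I)`. -/
def cone (X : PtdTop.{u}) : PtdTop.{u} :=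
  collapse (X × unitInterval) {p | p.1 = X.pt ∨ p.2 = 0} (X.pt, 1)

/-- The inclusion of `X` as the base of its cone, `x ↦ [x, 1]`. -/
def coneIncl (X : PtdTop.{u}) : X ⟶ cone X :=
  Hom.mk
    ⟨fun x => Quotient.mk (collapseSetoid {p : X × unitInterval | p.1 = X.pt ∨ p.2 = 0}) (x, 1),
      continuous_quotient_mk'.comp (by fun_prop)⟩
    rfl

/-- The reduced suspension `Σ X = X × I / (X × {0, 1} ∪ {*} × I)`. -/
def susp (X : PtdTop.{u}) : PtdTop.{u} :=
  collapse (X × unitInterval) {p | p.1 = X.pt ∨ p.2 = 0 ∨ p.2 = 1} (X.pt, 1)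

/-- The iterated reduced suspension `Σⁿ X`, where `Σ⁰ X = X`. -/
def iterSusp (X : PtdTop.{u}) : ℕ → PtdTop.{u}
  | 0 => X
  | n + 1 => susp (iterSusp X n)

/-- The wedge `X ∨ Y`. -/
def wedge₂ (X Y : PtdTop.{u}) : PtdTop.{u} :=
  collapse (X ⊕ Y) {Sum.inl X.pt, Sum.inr Y.pt} (Sum.inl X.pt)

/-- The inclusion `X → X ∨ Y`. -/
def inl (X Y : PtdTop.{u}) : X ⟶ wedge₂ X Y :=
  Hom.mk
    ⟨fun x => Quotient.mk (collapseSetoid {Sum.inl X.pt, Sum.inr Y.pt}) (Sum.inl x),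
      continuous_quotient_mk'.comp continuous_inl⟩
    rfl

/-- The inclusion `Y → X ∨ Y`. -/
def inr (X Y : PtdTop.{u}) : Y ⟶ wedge₂ X Y :=
  Hom.mk
    ⟨fun y => Quotient.mk (collapseSetoid {Sum.inl X.pt, Sum.inr Y.pt}) (Sum.inr y),
      continuous_quotient_mk'.comp continuous_inr⟩
    (Quotient.sound (s := collapseSetoid {Sum.inl X.pt, Sum.inr Y.pt})
      (Or.inr ⟨by simp, by simp⟩))

/-- The map `f + g : X ∨ Y → T` that is `f` on `X` and `g` on `Y`. -/
def desc₂ {X Y T : PtdTop.{u}} (f : X ⟶ T) (g : Y ⟶ T) : wedge₂ X Y ⟶ T :=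
  collapseDesc
    ⟨Sum.elim (Hom.toCont f) (Hom.toCont g),
      (Hom.toCont f).continuous.sumElim (Hom.toCont g).continuous⟩
    (by
      rintro x (rfl | rfl)
      · exact Hom.map_pt f
      · exact Hom.map_pt g)
    (by simp)

/-- The map `f ∨ g : X ∨ Y → X' ∨ Y'`. -/
def map₂ {X Y X' Y' : PtdTop.{u}} (f : X ⟶ X') (g : Y ⟶ Y') : wedge₂ X Y ⟶ wedge₂ X' Y' :=
  desc₂ (f ≫ inl X' Y') (g ≫ inr X' Y')

/-- The canonical map `(X ∨ Y) ∨ T → X ∨ (Y ∨ T)`. -/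
def assoc₂ (X Y T : PtdTop.{u}) : wedge₂ (wedge₂ X Y) T ⟶ wedge₂ X (wedge₂ Y T) :=
  desc₂ (desc₂ (inl X (wedge₂ Y T)) (inl Y T ≫ inr X (wedge₂ Y T)))
    (inr Y T ≫ inr X (wedge₂ Y T))

/-- The base points of the disjoint union of a family of pointed spaces and one extra point. -/
def wedgePts {J : Type u} (Y : J → PtdTop.{u}) : Set (PUnit.{u + 1} ⊕ (Σ j, Y j)) :=
  {z | z = Sum.inl PUnit.unit ∨ ∃ j, z = Sum.inr ⟨j, (Y j).pt⟩}

/-- The wedge `⋁ Y j` of a (possibly empty) family: the disjoint union of the `Y j` and of a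
point, with all base points identified. -/
def wedge {J : Type u} (Y : J → PtdTop.{u}) : PtdTop.{u} :=
  collapse (PUnit.{u + 1} ⊕ (Σ j, Y j)) (wedgePts Y) (Sum.inl PUnit.unit)

/-- The inclusion `Y j → ⋁ Y j` of a summand. -/
def wedgeIncl {J : Type u} (Y : J → PtdTop.{u}) (j : J) : Y j ⟶ wedge Y :=
  Hom.mk
    ⟨fun y => Quotient.mk (collapseSetoid (wedgePts Y)) (Sum.inr ⟨j, y⟩),
      continuous_quotient_mk'.comp (continuous_inr.comp continuous_sigmaMk)⟩
    (Quotient.sound (s := collapseSetoid (wedgePts Y))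
      (Or.inr ⟨Or.inr ⟨j, rfl⟩, Or.inl rfl⟩))

/-- The map `+ g j : ⋁ Y j → T` that is `g j` on the summand `Y j`. -/
def wedgeDesc {J : Type u} {Y : J → PtdTop.{u}} {T : PtdTop.{u}} (g : ∀ j, Y j ⟶ T) :
    wedge Y ⟶ T :=
  collapseDesc
    ⟨Sum.elim (fun _ => T.pt) (fun p => Hom.toCont (g p.1) p.2),
      continuous_const.sumElim (continuous_sigma fun j => (Hom.toCont (g j)).continuous)⟩
    (by
      rintro x (rfl | ⟨j, rfl⟩)
      · rfl
      · exact Hom.map_pt (g j))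
    (Or.inl rfl)

/-- The map `⋁ f j : ⋁ Y j → ⋁ Y' j`. -/
def wedgeMap {J : Type u} {Y Y' : J → PtdTop.{u}} (f : ∀ j, Y j ⟶ Y' j) : wedge Y ⟶ wedge Y' :=
  wedgeDesc fun j => f j ≫ wedgeIncl Y' j

/-! ### H-cogroups -/

/-- `A` is an H-cogroup: it has a comultiplication `ν : A → A ∨ A` and an inverse `ι : A → A` which
satisfy the (dual) group axioms up to pointed homotopy, the counit being the constant map. -/
def IsHCogroup (A : PtdTop.{u}) : Prop :=
  ∃ (ν : A ⟶ wedge₂ A A) (ι : A ⟶ A),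
    Homotopic (ν ≫ desc₂ (𝟙 A) (const A A)) (𝟙 A) ∧
    Homotopic (ν ≫ desc₂ (const A A) (𝟙 A)) (𝟙 A) ∧
    Homotopic (ν ≫ map₂ ν (𝟙 A) ≫ assoc₂ A A A) (ν ≫ map₂ (𝟙 A) ν) ∧
    Homotopic (ν ≫ desc₂ (𝟙 A) ι) (const A A) ∧
    Homotopic (ν ≫ desc₂ ι (𝟙 A)) (const A A)

/-! ### A-homotopy groups, A-weak equivalences -/

/-- `π_n^A(X) = [Σⁿ A, X]`. -/
def piA (A : PtdTop.{u}) (n : ℕ) (X : PtdTop.{u}) : Type u := HomotopyClasses (iterSusp A n) X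

/-- The map `f_* : π_n^A(X) → π_n^A(Y)`. -/
def piAMap (A : PtdTop.{u}) (n : ℕ) {X Y : PtdTop.{u}} (f : X ⟶ Y) : piA A n X → piA A n Y :=
  HomotopyClasses.map (iterSusp A n) f

/-- `f` is an `A`-weak equivalence: it induces isomorphisms on `π_n^A` for all `n ≥ 0`. (Where the
sets `π_n^A` carry group structures coming from `Σⁿ A`, the map `f_*` respects them, so that an
isomorphism is the same as a bijection.) -/
def IsAWeakEquiv (A : PtdTop.{u}) {X Y : PtdTop.{u}} (f : X ⟶ Y) : Prop :=
  ∀ n : ℕ, Function.Bijective (piAMap A n f)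

/-! ### Generalized CW(A)-complexes -/

/-- `X` is obtained from `B` by attaching `A`-cells, `j : B → X` being the structure map: for some
sets `J₀` (indexing the `A`-`0`-cells) and `J` (indexing the cells of dimension `m α + 1 ≥ 1`) and
attaching maps `g α : Σ^(m α) A → B`, the map `j` is part of a pushout square of
`⋁ Σ^(m α) A → (⋁ A) ∨ (⋁ C Σ^(m α) A)` along `+ g α`. -/
def AttachesCells (A : PtdTop.{u}) {B X : PtdTop.{u}} (j : B ⟶ X) : Prop :=
  ∃ (J₀ J : Type u) (m : J → ℕ) (g : ∀ α, iterSusp A (m α) ⟶ B)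
    (k : wedge₂ (wedge fun _ : J₀ => A) (wedge fun α => cone (iterSusp A (m α))) ⟶ X),
    IsPushout
      (wedgeDesc g)
      (wedgeMap (fun α => coneIncl (iterSusp A (m α))) ≫ inr (wedge fun _ : J₀ => A) _)
      j k

/-- `X` is a generalized CW(`A`)-complex: it is the colimit of a sequence
`* = X⁰ → X¹ → X² → ⋯` in which every space is obtained from the preceding one by attaching
`A`-cells. -/
def IsGenCW (A X : PtdTop.{u}) : Prop :=
  ∃ (F : ℕ ⥤ PtdTop.{u}) (ι : F ⟶ (Functor.const ℕ).obj X),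
    Subsingleton (F.obj 0) ∧
    (∀ n : ℕ, AttachesCells A (F.map (homOfLE (Nat.le_succ n)))) ∧
    Nonempty (IsColimit (Cocone.mk X ι))

end PtdTop

namespace PtdTop

open Topology

/-! The complex is the colimit of stages over `X`, starting with a point. Each stage attaches to the
previous stage `B`, with structure map `φ : B ⟶ X`, every cell that `X` allows: a copy of `A` for
each map `A ⟶ X`, and a cone on `Σᵐ A` for each `m`, each `g : Σᵐ A ⟶ B` and each extension of `g ≫
φ` over the cone. Cells of all dimensions may be attached at once, so no induction on dimension is
needed.

Surjectivity on `π_n^A` already holds at the first stage, and on the nose: for `n = 0` by the copies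
of `A`, and for `n + 1` because `Σⁿ⁺¹ A` is the cone on `Σⁿ A` with its base collapsed, hence a cell
attached along the constant map (`exists_lift_approxMap`).

The kernel is trivial by compactness: a map from `Σᵐ A` to the colimit factors through a stage
(`exists_factor_of_compact`), and if it is null-homotopic in `X` then a cone attached at the next
stage kills it (`homotopic_const_of_approxMap`). The factorization needs only that the stages are
`T₁` and that their inclusions are closed embeddings.

A trivial kernel gives injectivity because `[A, -]` is a group, naturally in the target. The
adjunction `[ΣW, Z] = [W, ΩZ]` carries this principle from `W` to `ΣW`, so no group structure on
`[Σⁿ A, Z]` is ever constructed. -/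

theorem hom_ext {X Y : PtdTop.{u}} {f g : X ⟶ Y}
    (h : ∀ x, Hom.toCont f x = Hom.toCont g x) : f = g :=
  Hom.ext (ContinuousMap.ext h)

@[simp] theorem const_comp {X Y Z : PtdTop.{u}} (g : Y ⟶ Z) : const X Y ≫ g = const X Z :=
  hom_ext fun _ => Hom.map_pt g

/-! ### Maps out of wedges and collapses -/

theorem collapse_ext {X : Type u} [TopologicalSpace X] {S : Set X} {x₀ : X} {Y : PtdTop.{u}}
    {f g : collapse X S x₀ ⟶ Y}
    (h : ∀ x, Hom.toCont f (Quotient.mk (collapseSetoid S) x) =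
      Hom.toCont g (Quotient.mk (collapseSetoid S) x)) : f = g :=
  hom_ext fun x => Quotient.inductionOn x h

@[simp] theorem inl_desc₂ {X Y T : PtdTop.{u}} (f : X ⟶ T) (g : Y ⟶ T) :
    inl X Y ≫ desc₂ f g = f := rfl

@[simp] theorem inr_desc₂ {X Y T : PtdTop.{u}} (f : X ⟶ T) (g : Y ⟶ T) :
    inr X Y ≫ desc₂ f g = g := rfl

theorem wedge₂_ext {X Y T : PtdTop.{u}} {f g : wedge₂ X Y ⟶ T}
    (hl : inl X Y ≫ f = inl X Y ≫ g) (hr : inr X Y ≫ f = inr X Y ≫ g) : f = g := by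
  refine collapse_ext ?_
  rintro (x | y)
  · exact congrArg (fun h : X ⟶ T => Hom.toCont h x) hl
  · exact congrArg (fun h : Y ⟶ T => Hom.toCont h y) hr

@[simp] theorem desc₂_comp {X Y T T' : PtdTop.{u}} (f : X ⟶ T) (g : Y ⟶ T) (h : T ⟶ T') :
    desc₂ f g ≫ h = desc₂ (f ≫ h) (g ≫ h) :=
  wedge₂_ext rfl rfl

theorem map₂_desc₂ {X Y X' Y' T : PtdTop.{u}} (f : X ⟶ X') (g : Y ⟶ Y') (h : X' ⟶ T)
    (k : Y' ⟶ T) : map₂ f g ≫ desc₂ h k = desc₂ (f ≫ h) (g ≫ k) := by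
  rw [map₂, desc₂_comp, Category.assoc, Category.assoc, inl_desc₂, inr_desc₂]

theorem assoc₂_desc₂ {X Y Z T : PtdTop.{u}} (f : X ⟶ T) (g : Y ⟶ T) (h : Z ⟶ T) :
    assoc₂ X Y Z ≫ desc₂ f (desc₂ g h) = desc₂ (desc₂ f g) h := by
  simp only [assoc₂, desc₂_comp, Category.assoc, inl_desc₂, inr_desc₂]

theorem wedge_ext {J : Type u} {Y : J → PtdTop.{u}} {T : PtdTop.{u}} {f g : wedge Y ⟶ T}
    (h : ∀ j, wedgeIncl Y j ≫ f = wedgeIncl Y j ≫ g) : f = g := by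
  refine collapse_ext ?_
  rintro (x | ⟨j, y⟩)
  · exact (Hom.map_pt f).trans (Hom.map_pt g).symm
  · exact congrArg (fun k : Y j ⟶ T => Hom.toCont k y) (h j)

/-! ### Homotopies as maps into the space of paths -/

/-- The space of free paths in `X`, pointed by the constant path. -/
def pathSpace (X : PtdTop.{u}) : PtdTop.{u} where
  carrier := C(unitInterval, X)
  pt := ContinuousMap.const _ X.pt

/-- Evaluation of paths at a time `t`. -/
def evalAt (X : PtdTop.{u}) (t : unitInterval) : pathSpace X ⟶ X :=
  Hom.mk ⟨fun γ : C(unitInterval, X) => γ t, ContinuousEvalConst.continuous_eval_const (F := C(unitInterval, X)) t⟩ rfl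

/-- Currying costs no hypothesis on `W`, since the interval is locally compact. Homotopies thereby
become morphisms, and every construction on morphisms applies to them. -/
theorem homotopic_iff {W X : PtdTop.{u}} {f g : W ⟶ X} :
    Homotopic f g ↔ ∃ H : W ⟶ pathSpace X, H ≫ evalAt X 0 = f ∧ H ≫ evalAt X 1 = g := by
  constructor
  · rintro ⟨H⟩
    refine ⟨Hom.mk ((H.toContinuousMap.comp ContinuousMap.prodSwap).curry) ?_,
      hom_ext fun w => H.apply_zero w, hom_ext fun w => H.apply_one w⟩
    refine ContinuousMap.ext fun t => ?_
    exact (H.eq_fst t (Set.mem_singleton _)).trans (Hom.map_pt f)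
  · rintro ⟨H, rfl, rfl⟩
    let H' : C(W, C(unitInterval, X)) := Hom.toCont H
    have hH : ∀ t, H' W.pt t = X.pt := fun t => congrArg (fun γ : C(unitInterval, X) => γ t) (Hom.map_pt H)
    refine ⟨⟨⟨⟨fun p => H' p.2 p.1, by fun_prop⟩, fun w => rfl, fun w => rfl⟩, ?_⟩⟩
    rintro t x rfl
    exact (hH t).trans (hH 0).symm

theorem Homotopic.refl {W X : PtdTop.{u}} (f : W ⟶ X) : Homotopic f f :=
  (homotopySetoid W X).refl f

theorem Homotopic.symm {W X : PtdTop.{u}} {f g : W ⟶ X} (h : Homotopic f g) : Homotopic g f :=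
  (homotopySetoid W X).symm h

theorem Homotopic.trans {W X : PtdTop.{u}} {f g h : W ⟶ X} (h₁ : Homotopic f g)
    (h₂ : Homotopic g h) : Homotopic f h :=
  (homotopySetoid W X).trans h₁ h₂

theorem Homotopic.precomp {V W X : PtdTop.{u}} {f g : W ⟶ X} (h : Homotopic f g) (k : V ⟶ W) :
    Homotopic (k ≫ f) (k ≫ g) := by
  obtain ⟨H, rfl, rfl⟩ := homotopic_iff.1 h
  exact homotopic_iff.2 ⟨k ≫ H, Category.assoc .., Category.assoc ..⟩

theorem Homotopic.desc₂ {X Y T : PtdTop.{u}} {f f' : X ⟶ T} {g g' : Y ⟶ T} (hf : Homotopic f f')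
    (hg : Homotopic g g') : Homotopic (PtdTop.desc₂ f g) (PtdTop.desc₂ f' g') := by
  obtain ⟨H, rfl, rfl⟩ := homotopic_iff.1 hf
  obtain ⟨K, rfl, rfl⟩ := homotopic_iff.1 hg
  exact homotopic_iff.2 ⟨PtdTop.desc₂ H K, desc₂_comp .., desc₂_comp ..⟩

/-! ### Detecting injectivity on the kernel -/

/-- For maps out of `W`, a map `f` is injective on homotopy classes as soon as its kernel is
trivial. -/
def InjectiveOfKernel (W : PtdTop.{u}) : Prop :=
  ∀ ⦃Z X : PtdTop.{u}⦄ (f : Z ⟶ X),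
    (∀ g : W ⟶ Z, Homotopic (g ≫ f) (const W X) → Homotopic g (const W Z)) →
    ∀ g₀ g₁ : W ⟶ Z, Homotopic (g₀ ≫ f) (g₁ ≫ f) → Homotopic g₀ g₁

/-- In multiplicative notation, `g₀ g₁⁻¹` lies in the kernel of `f`, so `g₀ = g₀ (g₁⁻¹ g₁) = (g₀
g₁⁻¹) g₁ = g₁` up to homotopy. -/
theorem IsHCogroup.injectiveOfKernel {A : PtdTop.{u}} (hA : A.IsHCogroup) :
    InjectiveOfKernel A := by
  obtain ⟨ν, ι, h1, h2, h3, h4, h5⟩ := hA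
  intro Z X f hf g₀ g₁ h
  have hd : Homotopic (ν ≫ PtdTop.desc₂ g₀ (ι ≫ g₁)) (const A Z) := by
    refine hf _ ?_
    have e := h4.postcomp (g₁ ≫ f)
    simp only [Category.assoc, desc₂_comp, Category.id_comp, const_comp] at e ⊢
    exact ((h.desc₂ (Homotopic.refl _)).precomp ν).trans e
  have e1 := h1.postcomp g₀
  have e2 := h2.postcomp g₁
  have e3 := h3.postcomp (PtdTop.desc₂ g₀ (PtdTop.desc₂ (ι ≫ g₁) g₁))
  have e5 := h5.postcomp g₁
  simp only [Category.assoc, desc₂_comp, Category.id_comp, const_comp, map₂_desc₂,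
    assoc₂_desc₂] at e1 e2 e3 e5
  refine e1.symm.trans <| Homotopic.trans ?_ <| e3.symm.trans <| Homotopic.trans ?_ e2
  · exact ((Homotopic.refl _).desc₂ e5.symm).precomp ν
  · exact (hd.desc₂ (Homotopic.refl _)).precomp ν

/-! ### Loop spaces and the adjunction with the suspension -/

/-- The loop space of `X`. -/
def loopSpace (X : PtdTop.{u}) : PtdTop.{u} where
  carrier := {γ : C(unitInterval, X) // γ 0 = X.pt ∧ γ 1 = X.pt}
  pt := ⟨ContinuousMap.const _ X.pt, rfl, rfl⟩

/-- The map of loop spaces induced by a map. -/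
def loopMap {X Y : PtdTop.{u}} (f : X ⟶ Y) : loopSpace X ⟶ loopSpace Y :=
  Hom.mk
    ⟨fun γ => ⟨(Hom.toCont f).comp γ.1, by simp [γ.2.1, Hom.map_pt f], by
        simp [γ.2.2, Hom.map_pt f]⟩,
      Continuous.subtype_mk ((ContinuousMap.continuous_postcomp _).comp continuous_subtype_val) _⟩
    (Subtype.ext (ContinuousMap.ext fun _ => Hom.map_pt f))

/-- The class of `(w, t)` in the suspension. -/
def suspMk (W : PtdTop.{u}) : C(W × unitInterval, susp W) :=
  ⟨Quotient.mk _, continuous_quotient_mk'⟩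

theorem suspMk_eq_pt {W : PtdTop.{u}} {p : W × unitInterval}
    (hp : p.1 = W.pt ∨ p.2 = 0 ∨ p.2 = 1) : suspMk W p = (susp W).pt :=
  Quotient.sound (Or.inr ⟨hp, Or.inl rfl⟩)

theorem susp_ext {W X : PtdTop.{u}} {f g : susp W ⟶ X}
    (h : ∀ w t, Hom.toCont f (suspMk W (w, t)) = Hom.toCont g (suspMk W (w, t))) : f = g :=
  collapse_ext fun x => h x.1 x.2

/-- The adjoint of a map out of a suspension. -/
def suspCurry {W X : PtdTop.{u}} (f : susp W ⟶ X) : W ⟶ loopSpace X :=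
  Hom.mk
    ⟨fun w => ⟨(((Hom.toCont f).comp (suspMk W)).curry w),
        (congrArg (Hom.toCont f) (suspMk_eq_pt (Or.inr (Or.inl rfl)))).trans (Hom.map_pt f),
        (congrArg (Hom.toCont f) (suspMk_eq_pt (Or.inr (Or.inr rfl)))).trans (Hom.map_pt f)⟩,
      Continuous.subtype_mk (ContinuousMap.continuous _) _⟩
    (Subtype.ext (ContinuousMap.ext fun _ =>
      (congrArg (Hom.toCont f) (suspMk_eq_pt (Or.inl rfl))).trans (Hom.map_pt f)))

/-- The adjoint of a map into a loop space. -/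
def suspUncurry {W X : PtdTop.{u}} (f : W ⟶ loopSpace X) : susp W ⟶ X :=
  collapseDesc
    ⟨fun p => (Hom.toCont f p.1).1 p.2,
      (continuous_subtype_val.comp ((Hom.toCont f).continuous.comp continuous_fst)).eval
        continuous_snd⟩
    (by
      rintro ⟨w, t⟩ (h | h | h)
      · obtain rfl : w = W.pt := h
        exact congrArg (fun γ : loopSpace X => γ.1 t) (Hom.map_pt f)
      · obtain rfl : t = 0 := h
        exact (Hom.toCont f w).2.1
      · obtain rfl : t = 1 := h
        exact (Hom.toCont f w).2.2)
    (Or.inl rfl)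

theorem suspUncurry_curry {W X : PtdTop.{u}} (f : susp W ⟶ X) : suspUncurry (suspCurry f) = f :=
  susp_ext fun _ _ => rfl

theorem suspUncurry_comp {W X Y : PtdTop.{u}} (f : W ⟶ loopSpace X) (g : X ⟶ Y) :
    suspUncurry (f ≫ loopMap g) = suspUncurry f ≫ g :=
  susp_ext fun _ _ => rfl

theorem suspUncurry_const {W X : PtdTop.{u}} : suspUncurry (const W (loopSpace X)) = const _ _ :=
  susp_ext fun _ _ => rfl

/-- Exchanging the two parameters of a loop of paths. -/
def loopPathSwap (X : PtdTop.{u}) : loopSpace (pathSpace X) ⟶ pathSpace (loopSpace X) :=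
  Hom.mk
    ⟨fun γ => ⟨fun t => ⟨(evalAt X t).toCont.comp γ.1,
        congrArg (evalAt X t).toCont γ.2.1, congrArg (evalAt X t).toCont γ.2.2⟩, by
          refine Continuous.subtype_mk (ContinuousMap.continuous_of_continuous_uncurry _ ?_) _
          let δ : C(unitInterval, C(unitInterval, X)) := γ.1
          change Continuous fun p : unitInterval × unitInterval => δ p.2 p.1
          fun_prop⟩, by
      refine ContinuousMap.continuous_of_continuous_uncurry _ ?_
      refine Continuous.subtype_mk (ContinuousMap.continuous_of_continuous_uncurry _ ?_) _
      let δ : loopSpace (pathSpace X) → C(unitInterval, C(unitInterval, X)) := fun γ => γ.1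
      have hδ : Continuous δ := continuous_subtype_val
      change Continuous fun p : (loopSpace (pathSpace X) × unitInterval) × unitInterval =>
        δ p.1.1 p.2 p.1.2
      fun_prop⟩
    rfl

/-- Exchanging the two parameters of a path of loops. -/
def pathLoopSwap (X : PtdTop.{u}) : pathSpace (loopSpace X) ⟶ loopSpace (pathSpace X) :=
  Hom.mk
    ⟨fun γ : C(unitInterval, loopSpace X) => ⟨⟨fun t => ⟨fun s => (γ s).1 t, by
          have h : Continuous fun s => (γ s).1 := continuous_subtype_val.comp γ.continuous
          fun_prop⟩, by
            refine ContinuousMap.continuous_of_continuous_uncurry _ ?_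
            have h : Continuous fun s => (γ s).1 := continuous_subtype_val.comp γ.continuous
            change Continuous fun p : unitInterval × unitInterval => (γ p.2).1 p.1
            fun_prop⟩,
        ContinuousMap.ext fun s => (γ s).2.1, ContinuousMap.ext fun s => (γ s).2.2⟩, by
      refine Continuous.subtype_mk (ContinuousMap.continuous_of_continuous_uncurry _ ?_) _
      refine ContinuousMap.continuous_of_continuous_uncurry _ ?_
      change Continuous fun p : (C(unitInterval, loopSpace X) × unitInterval) × unitInterval =>
        (p.1.1 p.2).1 p.1.2
      have h : Continuous fun p : (C(unitInterval, loopSpace X) × unitInterval) × unitInterval =>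
        (p.1.1 p.2).1 := continuous_subtype_val.comp
          ((continuous_fst.comp continuous_fst).eval continuous_snd)
      fun_prop⟩
    rfl

theorem Homotopic.suspCurry {W X : PtdTop.{u}} {f g : susp W ⟶ X} (h : Homotopic f g) :
    Homotopic (PtdTop.suspCurry f) (PtdTop.suspCurry g) := by
  obtain ⟨H, rfl, rfl⟩ := homotopic_iff.1 h
  exact homotopic_iff.2 ⟨PtdTop.suspCurry H ≫ loopPathSwap X, rfl, rfl⟩

theorem Homotopic.suspUncurry {W X : PtdTop.{u}} {f g : W ⟶ loopSpace X} (h : Homotopic f g) :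
    Homotopic (PtdTop.suspUncurry f) (PtdTop.suspUncurry g) := by
  obtain ⟨H, rfl, rfl⟩ := homotopic_iff.1 h
  exact homotopic_iff.2 ⟨PtdTop.suspUncurry (H ≫ pathLoopSwap X), susp_ext fun _ _ => rfl,
    susp_ext fun _ _ => rfl⟩

/-- By adjunction this is the property of `W` for the looped map `loopMap f`; it matters here that
`InjectiveOfKernel` quantifies over all targets and maps. -/
theorem InjectiveOfKernel.susp {W : PtdTop.{u}} (hW : InjectiveOfKernel W) :
    InjectiveOfKernel (susp W) := by
  intro Z X f hf g₀ g₁ h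
  have key := hW (loopMap f) (fun g hg => ?_) (suspCurry g₀) (suspCurry g₁) h.suspCurry
  · simpa only [suspUncurry_curry] using key.suspUncurry
  · have h' := hg.suspUncurry
    rw [suspUncurry_comp, suspUncurry_const] at h'
    exact (hf _ h').suspCurry

theorem InjectiveOfKernel.iterSusp {W : PtdTop.{u}} (hW : InjectiveOfKernel W) (n : ℕ) :
    InjectiveOfKernel (iterSusp W n) := by
  induction n with
  | zero => exact hW
  | succ n ih => exact ih.susp

/-! ### Separation and closed maps -/

theorem t1Space_of_isClosedMap {X Y : Type*} [TopologicalSpace X] [TopologicalSpace Y] [T1Space X]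
    {f : X → Y} (hf : IsClosedMap f) (hs : Function.Surjective f) : T1Space Y := by
  refine ⟨fun y => ?_⟩
  obtain ⟨x, rfl⟩ := hs y
  simpa using hf {x} isClosed_singleton

theorem t1Space_sum {X Y : Type*} [TopologicalSpace X] [TopologicalSpace Y] [T1Space X]
    [T1Space Y] : T1Space (X ⊕ Y) := by
  refine ⟨?_⟩
  rintro (x | y)
  · simpa using isClosedMap_inl (X := X) (Y := Y) {x} isClosed_singleton
  · simpa using isClosedMap_inr (X := X) (Y := Y) {y} isClosed_singleton

theorem t1Space_sigma {J : Type*} {Y : J → Type*} [∀ j, TopologicalSpace (Y j)]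
    [∀ j, T1Space (Y j)] : T1Space (Σ j, Y j) := by
  refine ⟨?_⟩
  rintro ⟨j, y⟩
  simpa using isClosedMap_sigmaMk (σ := Y) {y} isClosed_singleton

theorem isClosedMap_sigmaMap {J : Type*} {Y Y' : J → Type*} [∀ j, TopologicalSpace (Y j)]
    [∀ j, TopologicalSpace (Y' j)] {f : ∀ j, Y j → Y' j} (hf : ∀ j, IsClosedMap (f j)) :
    IsClosedMap (Sigma.map id f) := by
  intro C hC
  rw [isClosed_sigma_iff]
  intro j
  convert hf j _ (hC.preimage (continuous_sigmaMk (i := j))) using 1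
  ext y
  constructor
  · rintro ⟨⟨i, x⟩, hx, h⟩
    obtain ⟨rfl, h⟩ := Sigma.mk.inj_iff.1 h
    exact ⟨x, hx, eq_of_heq h⟩
  · rintro ⟨x, hx, rfl⟩
    exact ⟨⟨j, x⟩, hx, rfl⟩

theorem collapse_mk_eq_iff {X : Type u} {S : Set X} {x y : X} :
    Quotient.mk (collapseSetoid S) x = Quotient.mk (collapseSetoid S) y ↔
      x = y ∨ (x ∈ S ∧ y ∈ S) :=
  ⟨fun h => Quotient.exact h, fun h => Quotient.sound h⟩

theorem isClosedMap_collapse_mk {X : Type u} [TopologicalSpace X] {S : Set X} (hS : IsClosed S) :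
    IsClosedMap (Quotient.mk (collapseSetoid S)) := by
  intro C hC
  rw [← (isQuotientMap_quotient_mk' (s := collapseSetoid S)).isClosed_preimage]
  -- The saturation of `C` is `C ∪ S` if `C` meets `S`, and `C` otherwise.
  have h : Quotient.mk (collapseSetoid S) ⁻¹' (Quotient.mk (collapseSetoid S) '' C) =
      C ∪ {x | x ∈ S ∧ (C ∩ S).Nonempty} := by
    ext x
    constructor
    · rintro ⟨y, hy, hxy⟩
      rcases collapse_mk_eq_iff.1 hxy with rfl | ⟨h1, h2⟩
      · exact Or.inl hy
      · exact Or.inr ⟨h2, y, hy, h1⟩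
    · rintro (hx | ⟨hx, y, hy, hyS⟩)
      · exact ⟨x, hx, rfl⟩
      · exact ⟨y, hy, collapse_mk_eq_iff.2 (Or.inr ⟨hyS, hx⟩)⟩
  refine (congrArg IsClosed h).mpr (hC.union ?_)
  exact hS.inter isClosed_const

theorem t1Space_collapse {X : Type u} [TopologicalSpace X] [T1Space X] {S : Set X} {x₀ : X}
    (hS : IsClosed S) : T1Space (collapse X S x₀) :=
  t1Space_of_isClosedMap (isClosedMap_collapse_mk hS) Quotient.mk_surjective

theorem isClosed_coneSet (X : PtdTop.{u}) [T1Space X] :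
    IsClosed {p : X × unitInterval | p.1 = X.pt ∨ p.2 = 0} :=
  (isClosed_singleton.preimage continuous_fst).union (isClosed_singleton.preimage continuous_snd)

instance (X : PtdTop.{u}) [T1Space X] : T1Space (cone X) :=
  t1Space_collapse (isClosed_coneSet X)

instance (X : PtdTop.{u}) [T1Space X] : T1Space (susp X) :=
  t1Space_collapse <| (isClosed_singleton.preimage continuous_fst).union <|
    (isClosed_singleton.preimage continuous_snd).union
      (isClosed_singleton.preimage continuous_snd)

instance (X : PtdTop.{u}) [CompactSpace X] : CompactSpace (susp X) :=
  inferInstanceAs (CompactSpace (Quotient _))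

instance t1Space_iterSusp (X : PtdTop.{u}) [T1Space X] (n : ℕ) : T1Space (iterSusp X n) := by
  induction n with
  | zero => assumption
  | succ n ih => exact inferInstanceAs (T1Space (susp (iterSusp X n)))

instance compactSpace_iterSusp (X : PtdTop.{u}) [CompactSpace X] (n : ℕ) :
    CompactSpace (iterSusp X n) := by
  induction n with
  | zero => assumption
  | succ n ih => exact inferInstanceAs (CompactSpace (susp (iterSusp X n)))

theorem isClosed_wedgePts {J : Type u} (Y : J → PtdTop.{u}) [∀ j, T1Space (Y j)] :
    IsClosed (wedgePts Y) := by
  refine isClosed_sum_iff.2 ⟨?_, isClosed_sigma_iff.2 fun j => ?_⟩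
  · convert isClosed_univ
    ext x
    simp [wedgePts]
  · convert isClosed_singleton (x := (Y j).pt)
    ext y
    constructor
    · rintro (h | ⟨i, h⟩)
      · cases h
      · obtain ⟨rfl, h⟩ := Sigma.mk.inj_iff.1 (Sum.inr_injective h)
        exact eq_of_heq h
    · rintro rfl
      exact Or.inr ⟨j, rfl⟩

instance {J : Type u} (Y : J → PtdTop.{u}) [∀ j, T1Space (Y j)] : T1Space (wedge Y) :=
  have := t1Space_sigma (Y := fun j => Y j)
  have := t1Space_sum (X := PUnit.{u + 1}) (Y := Σ j, Y j)
  t1Space_collapse (isClosed_wedgePts Y)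

theorem isClosed_wedge₂Pts (X Y : PtdTop.{u}) [T1Space X] [T1Space Y] :
    IsClosed ({Sum.inl X.pt, Sum.inr Y.pt} : Set (X ⊕ Y)) :=
  have := t1Space_sum (X := X) (Y := Y)
  (Set.toFinite _).isClosed

instance (X Y : PtdTop.{u}) [T1Space X] [T1Space Y] : T1Space (wedge₂ X Y) :=
  have := t1Space_sum (X := X) (Y := Y)
  t1Space_collapse (isClosed_wedge₂Pts X Y)

theorem isClosedEmbedding_coneIncl (X : PtdTop.{u}) [T1Space X] :
    IsClosedEmbedding (Hom.toCont (coneIncl X)) := by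
  refine .of_continuous_injective_isClosedMap (ContinuousMap.continuous _) ?_ ?_
  · intro x y h
    rcases collapse_mk_eq_iff.1 h with h | ⟨h1, h2⟩
    · exact congrArg Prod.fst h
    · have h1' : x = X.pt := h1.resolve_right one_ne_zero
      have h2' : y = X.pt := h2.resolve_right one_ne_zero
      rw [h1', h2']
  · refine (isClosedMap_collapse_mk (isClosed_coneSet X)).comp (f := fun x : X => (x, 1)) ?_
    intro C hC
    convert hC.prod (isClosed_singleton (x := (1 : unitInterval))) using 1
    ext ⟨x, t⟩
    simp [eq_comm]

theorem isClosedEmbedding_inr (X Y : PtdTop.{u}) [T1Space X] [T1Space Y] :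
    IsClosedEmbedding (Hom.toCont (inr X Y)) := by
  refine .of_continuous_injective_isClosedMap (ContinuousMap.continuous _) ?_
    ((isClosedMap_collapse_mk (isClosed_wedge₂Pts X Y)).comp isClosedMap_inr)
  intro x y h
  rcases collapse_mk_eq_iff.1 h with h | ⟨h1, h2⟩
  · exact Sum.inr_injective h
  · simp only [Set.mem_insert_iff, reduceCtorEq, Set.mem_singleton_iff, Sum.inr.injEq,
      false_or] at h1 h2
    rw [h1, h2]

theorem isClosedEmbedding_wedgeMap {J : Type u} {Y Y' : J → PtdTop.{u}} [∀ j, T1Space (Y' j)]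
    (f : ∀ j, Y j ⟶ Y' j) (hf : ∀ j, IsClosedEmbedding (Hom.toCont (f j))) :
    IsClosedEmbedding (Hom.toCont (wedgeMap f)) := by
  refine .of_continuous_injective_isClosedMap (ContinuousMap.continuous _) ?_ ?_
  -- Since `f j` is injective and pointed, only the base point goes to the base point.
  · have key : ∀ (j : J) (y : Y j), Sum.inr ⟨j, Hom.toCont (f j) y⟩ ∈ wedgePts Y' →
        Sum.inr ⟨j, y⟩ ∈ wedgePts Y := by
      rintro j y (h | ⟨i, h⟩)
      · cases h
      · obtain ⟨rfl, h⟩ := Sigma.mk.inj_iff.1 (Sum.inr_injective h)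
        exact Or.inr ⟨j, by rw [(hf j).injective ((eq_of_heq h).trans (Hom.map_pt (f j)).symm)]⟩
    intro x y
    refine Quotient.inductionOn₂ x y ?_
    rintro (a | ⟨i, a⟩) (b | ⟨j, b⟩) h
    · rfl
    · rcases collapse_mk_eq_iff.1 h with h | ⟨h1, h2⟩
      · cases h
      · exact collapse_mk_eq_iff.2 (Or.inr ⟨Or.inl rfl, key _ _ h2⟩)
    · rcases collapse_mk_eq_iff.1 h with h | ⟨h1, h2⟩
      · cases h
      · exact collapse_mk_eq_iff.2 (Or.inr ⟨key _ _ h1, Or.inl rfl⟩)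
    · rcases collapse_mk_eq_iff.1 h with h | ⟨h1, h2⟩
      · obtain ⟨rfl, h⟩ := Sigma.mk.inj_iff.1 (Sum.inr_injective h)
        exact congrArg (fun y => Quotient.mk (collapseSetoid (wedgePts Y)) (Sum.inr ⟨i, y⟩))
          ((hf i).injective (eq_of_heq h))
      · exact collapse_mk_eq_iff.2 (Or.inr ⟨key _ _ h1, key _ _ h2⟩)
  -- Closedness is checked after composing with the quotient map from the disjoint union, where the
  -- map acts summand by summand.
  · refine IsClosedMap.of_comp_surjective (f := Quotient.mk (collapseSetoid (wedgePts Y)))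
      Quotient.mk_surjective continuous_quotient_mk' ?_
    have h := (isClosedMap_collapse_mk (isClosed_wedgePts Y')).comp
      ((IsClosedMap.id (X := PUnit.{u + 1})).sumMap
        (isClosedMap_sigmaMap fun j => (hf j).isClosedMap))
    have e : Hom.toCont (wedgeMap f) ∘ Quotient.mk (collapseSetoid (wedgePts Y)) =
        Quotient.mk (collapseSetoid (wedgePts Y')) ∘
          Sum.map id (Sigma.map id fun j => Hom.toCont (f j)) := by
      funext x
      rcases x with x | x <;> rfl
    exact (congrArg IsClosedMap e).mpr h

/-! ### Gluing along a closed embedding -/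

section Glue

variable {S B D : PtdTop.{u}} (φ : S ⟶ B) (j : S ⟶ D)

open Classical in
/-- The representative, in the disjoint union of `B` and `D`, of a point of the gluing. -/
noncomputable def glueRep : B ⊕ D → B ⊕ D
  | Sum.inl b => Sum.inl b
  | Sum.inr d =>
    if h : ∃ s, Hom.toCont j s = d then Sum.inl (Hom.toCont φ h.choose) else Sum.inr d

variable {j} in
-- Injectivity of `j` makes the chosen preimage unique, so the kernel of `glueRep` is exactly the
-- relation generated by `φ s ∼ j s`.
theorem glueRep_image (hj : Function.Injective (Hom.toCont j)) (s : S) :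
    glueRep φ j (Sum.inr (Hom.toCont j s)) = Sum.inl (Hom.toCont φ s) := by
  have h : ∃ s', Hom.toCont j s' = Hom.toCont j s := ⟨s, rfl⟩
  rw [glueRep, dif_pos h, hj h.choose_spec]

theorem glueRep_of_notMem {d : D} (hd : ∀ s, Hom.toCont j s ≠ d) :
    glueRep φ j (Sum.inr d) = Sum.inr d :=
  dif_neg fun ⟨s, hs⟩ => hd s hs

/-- The space obtained from `B` by gluing `D` to it along `φ : S → B`, where `j : S → D`. -/
noncomputable def glue : PtdTop.{u} where
  carrier := Quotient (Setoid.ker (glueRep φ j))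
  top := inferInstance
  pt := Quotient.mk _ (Sum.inl B.pt)

/-- The quotient map onto the gluing. -/
noncomputable def glueMk (x : B ⊕ D) : glue φ j := Quotient.mk (Setoid.ker (glueRep φ j)) x

theorem isQuotientMap_glueMk : IsQuotientMap (glueMk φ j) :=
  isQuotientMap_quotient_mk' (s := Setoid.ker (glueRep φ j))

theorem glueMk_eq_iff {x y : B ⊕ D} : glueMk φ j x = glueMk φ j y ↔ glueRep φ j x = glueRep φ j y :=
  Quotient.eq (r := Setoid.ker (glueRep φ j))

/-- The map from `B` to the gluing. -/
noncomputable def glueInl : B ⟶ glue φ j :=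
  Hom.mk ⟨fun b => glueMk φ j (Sum.inl b),
    (isQuotientMap_glueMk φ j).continuous.comp continuous_inl⟩ rfl

variable {j}

theorem glueMk_image (hj : Function.Injective (Hom.toCont j)) (s : S) :
    glueMk φ j (Sum.inr (Hom.toCont j s)) = glueMk φ j (Sum.inl (Hom.toCont φ s)) :=
  (glueMk_eq_iff φ j).2 (glueRep_image φ hj s)

/-- The map from `D` to the gluing. -/
noncomputable def glueInr (hj : Function.Injective (Hom.toCont j)) : D ⟶ glue φ j :=
  Hom.mk ⟨fun d => glueMk φ j (Sum.inr d),
    (isQuotientMap_glueMk φ j).continuous.comp continuous_inr⟩ (by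
      change glueMk φ j (Sum.inr D.pt) = glueMk φ j (Sum.inl B.pt)
      rw [← Hom.map_pt j, glueMk_image φ hj, Hom.map_pt φ])

theorem glue_condition (hj : Function.Injective (Hom.toCont j)) : φ ≫ glueInl φ j = j ≫ glueInr φ hj :=
  hom_ext fun s => (glueMk_image φ hj s).symm

theorem elim_glueRep {T : PtdTop.{u}} {a : B ⟶ T} {b : D ⟶ T} (h : φ ≫ a = j ≫ b) (x : B ⊕ D) :
    Sum.elim (Hom.toCont a) (Hom.toCont b) (glueRep φ j x) =
      Sum.elim (Hom.toCont a) (Hom.toCont b) x := by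
  rcases x with x | d
  · rfl
  · by_cases hd : ∃ s, Hom.toCont j s = d
    · rw [glueRep, dif_pos hd]
      conv_rhs => rw [← hd.choose_spec]
      exact congrArg (fun k : S ⟶ T => Hom.toCont k hd.choose) h
    · rw [glueRep, dif_neg hd]

/-- The map out of the gluing given by compatible maps. -/
noncomputable def glueDesc {T : PtdTop.{u}} (a : B ⟶ T) (b : D ⟶ T) (h : φ ≫ a = j ≫ b) :
    glue φ j ⟶ T :=
  Hom.mk
    ⟨Quotient.lift (s := Setoid.ker (glueRep φ j)) (Sum.elim (Hom.toCont a) (Hom.toCont b))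
      fun x y hxy => by
        rw [← elim_glueRep φ h x, ← elim_glueRep φ h y]
        exact congrArg _ hxy,
      ((Hom.toCont a).continuous.sumElim (Hom.toCont b).continuous).quotient_lift _⟩
    (Hom.map_pt a)

theorem glueInl_desc {T : PtdTop.{u}} (a : B ⟶ T) (b : D ⟶ T) (h : φ ≫ a = j ≫ b) :
    glueInl φ j ≫ glueDesc φ a b h = a := rfl

theorem glueInr_desc (hj : Function.Injective (Hom.toCont j)) {T : PtdTop.{u}} (a : B ⟶ T) (b : D ⟶ T) (h : φ ≫ a = j ≫ b) :
    glueInr φ hj ≫ glueDesc φ a b h = b := rfl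

theorem isPushout_glue (hj : Function.Injective (Hom.toCont j)) : IsPushout φ j (glueInl φ j) (glueInr φ hj) where
  w := glue_condition φ hj
  isColimit' := ⟨PushoutCocone.IsColimit.mk _ (fun s => glueDesc φ s.inl s.inr s.condition)
    (fun s => glueInl_desc φ _ _ _) (fun s => glueInr_desc φ hj _ _ _) fun s m h1 h2 => by
      refine hom_ext fun x => Quotient.inductionOn x ?_
      rintro (b | d)
      · exact congrArg (fun k : B ⟶ s.pt => Hom.toCont k b) h1
      · exact congrArg (fun k : D ⟶ s.pt => Hom.toCont k d) h2⟩

theorem preimage_inr_glueMk_inl (hj : Function.Injective (Hom.toCont j)) (C : Set B) :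
    Sum.inr ⁻¹' (glueMk φ j ⁻¹' (Hom.toCont (glueInl φ j) '' C)) =
      Hom.toCont j '' (Hom.toCont φ ⁻¹' C) := by
  ext d
  constructor
  · rintro ⟨b, hb, h⟩
    have h' : Sum.inl b = glueRep φ j (Sum.inr d) := (glueMk_eq_iff φ j).1 h
    by_cases hd : ∃ s, Hom.toCont j s = d
    · obtain ⟨s, rfl⟩ := hd
      rw [glueRep_image φ hj] at h'
      exact ⟨s, by rwa [Set.mem_preimage, ← Sum.inl_injective h'], rfl⟩
    · rw [glueRep_of_notMem φ j fun s hs => hd ⟨s, hs⟩] at h'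
      cases h'
  · rintro ⟨s, hs, rfl⟩
    exact ⟨_, hs, (glueMk_image φ hj s).symm⟩

theorem glueInl_injective : Function.Injective (Hom.toCont (glueInl φ j)) := fun _ _ h =>
  Sum.inl_injective ((glueMk_eq_iff φ j).1 h)

/-- The preimage of the image of `C` is `C` itself in `B` and `j (φ⁻¹ C)` in `D`; both are closed.
-/
theorem isClosedEmbedding_glueInl (hj : IsClosedEmbedding (Hom.toCont j)) :
    IsClosedEmbedding (Hom.toCont (glueInl φ j)) := by
  refine .of_continuous_injective_isClosedMap (ContinuousMap.continuous _)
    (glueInl_injective φ) fun C hC => ?_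
  rw [← (isQuotientMap_glueMk φ j).isClosed_preimage, isClosed_sum_iff]
  constructor
  · convert hC using 1
    exact Set.preimage_image_eq C (glueInl_injective φ)
  · rw [preimage_inr_glueMk_inl φ hj.injective]
    exact hj.isClosedMap _ (hC.preimage (ContinuousMap.continuous _))

theorem t1Space_glue [T1Space B] [T1Space D] (hj : IsClosedEmbedding (Hom.toCont j)) :
    T1Space (glue φ j) := by
  have hB : ∀ b : B, IsClosed {Hom.toCont (glueInl φ j) b} := fun b => by
    simpa using (isClosedEmbedding_glueInl φ hj).isClosedMap {b} isClosed_singleton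
  refine ⟨fun x => ?_⟩
  obtain ⟨b | d, rfl⟩ := (isQuotientMap_glueMk φ j).surjective x
  · exact hB b
  · by_cases hd : ∃ s, Hom.toCont j s = d
    · obtain ⟨s, rfl⟩ := hd
      rw [glueMk_image φ hj.injective]
      exact hB _
    -- A point of `D` outside the image of `j` is identified with no other point.
    · have hd' := glueRep_of_notMem φ j fun s hs => hd ⟨s, hs⟩
      have := t1Space_sum (X := B) (Y := D)
      rw [← (isQuotientMap_glueMk φ j).isClosed_preimage]
      convert isClosed_singleton (x := (Sum.inr d : B ⊕ D))
      ext y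
      simp only [Set.mem_preimage, Set.mem_singleton_iff, glueMk_eq_iff, hd']
      refine ⟨fun h => ?_, fun h => h ▸ hd'⟩
      rcases y with b | d'
      · cases h
      · by_cases hd2 : ∃ s, Hom.toCont j s = d'
        · obtain ⟨s, rfl⟩ := hd2
          rw [glueRep_image φ hj.injective] at h
          cases h
        · rwa [glueRep_of_notMem φ j fun s hs => hd2 ⟨s, hs⟩] at h

end Glue

/-! ### Maps out of cones -/

theorem exists_cone_extension {W X : PtdTop.{u}} {g : W ⟶ X} (h : Homotopic g (const W X)) :
    ∃ k : cone W ⟶ X, coneIncl W ≫ k = g := by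
  -- The homotopy is reversed because the cone is collapsed at time `0`.
  obtain ⟨H, h0, rfl⟩ := homotopic_iff.1 h.symm
  let H' : C(W, C(unitInterval, X)) := Hom.toCont H
  refine ⟨collapseDesc ⟨fun p => H' p.1 p.2, by fun_prop⟩ ?_ (Or.inl rfl), rfl⟩
  rintro ⟨w, t⟩ (h | h)
  · obtain rfl : w = W.pt := h
    exact congrArg (fun γ : C(unitInterval, X) => γ t) (Hom.map_pt H)
  · obtain rfl : t = 0 := h
    exact congrArg (fun k : W ⟶ X => Hom.toCont k w) h0

/-- The class of `(w, t)` in the cone. -/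
def coneMk (W : PtdTop.{u}) : C(W × unitInterval, cone W) :=
  ⟨Quotient.mk _, continuous_quotient_mk'⟩

theorem coneMk_eq_pt {W : PtdTop.{u}} {p : W × unitInterval} (hp : p.1 = W.pt ∨ p.2 = 0) :
    coneMk W p = (cone W).pt :=
  Quotient.sound (Or.inr ⟨hp, Or.inl rfl⟩)

theorem homotopic_coneIncl (W : PtdTop.{u}) : Homotopic (coneIncl W) (const W (cone W)) := by
  refine (homotopic_iff.2 ⟨Hom.mk (coneMk W).curry ?_, ?_, rfl⟩).symm
  · exact ContinuousMap.ext fun t => coneMk_eq_pt (Or.inl rfl)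
  · exact hom_ext fun w => coneMk_eq_pt (Or.inr rfl)

/-- The quotient map from the cone to the suspension. -/
def coneToSusp (W : PtdTop.{u}) : cone W ⟶ susp W :=
  collapseDesc (suspMk W) (fun _ hp => suspMk_eq_pt (hp.imp_right Or.inl)) (Or.inl rfl)

theorem coneIncl_toSusp (W : PtdTop.{u}) : coneIncl W ≫ coneToSusp W = const W (susp W) :=
  hom_ext fun _ => suspMk_eq_pt (Or.inr (Or.inr rfl))

theorem exists_coneToSusp_comp {W Y : PtdTop.{u}} (k : cone W ⟶ Y)
    (hk : coneIncl W ≫ k = const W Y) : ∃ k' : susp W ⟶ Y, coneToSusp W ≫ k' = k := by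
  refine ⟨collapseDesc ((Hom.toCont k).comp (coneMk W)) ?_ (Or.inl rfl),
    collapse_ext fun _ => rfl⟩
  rintro ⟨w, t⟩ (h | h | h)
  · exact (congrArg (Hom.toCont k) (coneMk_eq_pt (Or.inl h))).trans (Hom.map_pt k)
  · exact (congrArg (Hom.toCont k) (coneMk_eq_pt (Or.inr h))).trans (Hom.map_pt k)
  · obtain rfl : t = 1 := h
    exact congrArg (fun u : W ⟶ Y => Hom.toCont u w) hk

theorem coneToSusp_cancel {W Y : PtdTop.{u}} {f g : susp W ⟶ Y}
    (h : coneToSusp W ≫ f = coneToSusp W ≫ g) : f = g :=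
  susp_ext fun w t => congrArg (fun u : cone W ⟶ Y => Hom.toCont u (coneMk W (w, t))) h

/-! ### Sequential colimits -/

/-- The underlying space, as a functor. -/
def toTop : PtdTop.{u} ⥤ TopCat.{u} where
  obj X := TopCat.of X
  map f := TopCat.ofHom (Hom.toCont f)

section Colimit

variable (F : ℕ ⥤ PtdTop.{u})

/-- The colimit of a sequence of pointed spaces. -/
noncomputable def seqColimit : PtdTop.{u} where
  carrier := (colimit (F ⋙ toTop) : TopCat.{u})
  pt := colimit.ι (F ⋙ toTop) 0 (F.obj 0).pt

/-- The maps to the colimit of a sequence. -/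
noncomputable def seqColimitι : F ⟶ (Functor.const ℕ).obj (seqColimit F) where
  app n := Hom.mk (colimit.ι (F ⋙ toTop) n).hom (by
    have h := ConcreteCategory.congr_hom
      (colimit.w (F ⋙ toTop) (homOfLE (Nat.zero_le n))) (F.obj 0).pt
    refine Eq.trans ?_ h
    exact congrArg (colimit.ι (F ⋙ toTop) n)
      (Hom.map_pt (F.map (homOfLE (Nat.zero_le n)))).symm)
  naturality i j f := hom_ext fun x =>
    ConcreteCategory.congr_hom (colimit.w (F ⋙ toTop) f) x

/-- The cocone on the underlying spaces of a cocone of pointed spaces. -/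
def topCocone (s : Cocone F) : Cocone (F ⋙ toTop) where
  pt := TopCat.of s.pt
  ι :=
    { app := fun n => TopCat.ofHom (Hom.toCont (s.ι.app n))
      naturality := fun _ _ f => congrArg (fun k => TopCat.ofHom (Hom.toCont k)) (s.ι.naturality f) }

theorem seqColimit_exists_rep (z : seqColimit F) :
    ∃ n x, Hom.toCont ((seqColimitι F).app n) x = z := by
  obtain ⟨n, x, h⟩ := Concrete.colimit_exists_rep (F ⋙ toTop) (show ToType (colimit _) from z)
  exact ⟨n, x, h⟩

/-- The universal property of the colimit of a sequence. -/
noncomputable def isColimitSeqColimit : IsColimit (Cocone.mk (seqColimit F) (seqColimitι F)) where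
  desc s := Hom.mk (colimit.desc (F ⋙ toTop) (topCocone F s)).hom
    ((ConcreteCategory.congr_hom (colimit.ι_desc (topCocone F s) 0) (F.obj 0).pt).trans
      (Hom.map_pt (s.ι.app 0)))
  fac s n := hom_ext fun x => ConcreteCategory.congr_hom (colimit.ι_desc (topCocone F s) n) x
  uniq s m hm := hom_ext fun z => by
    obtain ⟨n, x, rfl⟩ := seqColimit_exists_rep F z
    exact (congrArg (fun k : F.obj n ⟶ s.pt => Hom.toCont k x) (hm n)).trans
      (ConcreteCategory.congr_hom (colimit.ι_desc (topCocone F s) n) x).symm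

theorem isClosed_seqColimit_iff (C : Set (seqColimit F)) :
    IsClosed C ↔ ∀ n, IsClosed (Hom.toCont ((seqColimitι F).app n) ⁻¹' C) :=
  TopCat.isClosed_iff_of_isColimit _ (colimit.isColimit (F ⋙ toTop)) C

theorem seqColimitι_map {m n : ℕ} (h : m ≤ n) (x : F.obj m) :
    Hom.toCont ((seqColimitι F).app n) (Hom.toCont (F.map (homOfLE h)) x) =
      Hom.toCont ((seqColimitι F).app m) x :=
  ConcreteCategory.congr_hom (colimit.w (F ⋙ toTop) (homOfLE h)) x

variable {F}

theorem isClosedEmbedding_map_of_succ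
    (hF : ∀ n, IsClosedEmbedding (Hom.toCont (F.map (homOfLE (Nat.le_succ n)))))
    {m n : ℕ} (h : m ≤ n) : IsClosedEmbedding (Hom.toCont (F.map (homOfLE h))) := by
  induction n, h using Nat.le_induction with
  | base =>
    have e : F.map (homOfLE le_rfl) = 𝟙 (F.obj m) := F.map_id m
    rw [e]
    exact .id
  | succ n h ih =>
    have e : F.map (homOfLE (h.trans (Nat.le_succ n))) =
        F.map (homOfLE h) ≫ F.map (homOfLE (Nat.le_succ n)) := by
      rw [← F.map_comp, homOfLE_comp]
    rw [e]
    exact (hF n).comp ih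

theorem seqColimitι_injective
    (hF : ∀ n, IsClosedEmbedding (Hom.toCont (F.map (homOfLE (Nat.le_succ n))))) (n : ℕ) :
    Function.Injective (Hom.toCont ((seqColimitι F).app n)) := by
  intro x y h
  obtain ⟨k, a, b, hab⟩ := Concrete.colimit_exists_of_rep_eq (F ⋙ toTop) x y h
  obtain rfl := Subsingleton.elim a b
  exact (isClosedEmbedding_map_of_succ hF (leOfHom a)).injective hab

theorem isClosedEmbedding_seqColimitι
    (hF : ∀ n, IsClosedEmbedding (Hom.toCont (F.map (homOfLE (Nat.le_succ n))))) (n : ℕ) :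
    IsClosedEmbedding (Hom.toCont ((seqColimitι F).app n)) := by
  refine .of_continuous_injective_isClosedMap (ContinuousMap.continuous _)
    (seqColimitι_injective hF n) fun C hC => ?_
  rw [isClosed_seqColimit_iff]
  intro m
  rcases le_total n m with h | h
  · convert (isClosedEmbedding_map_of_succ hF h).isClosedMap C hC using 1
    rw [← Set.preimage_image_eq (_ '' C) (seqColimitι_injective hF m), Set.image_image]
    simp only [seqColimitι_map]
  · convert hC.preimage (Hom.toCont (F.map (homOfLE h))).continuous using 1
    ext x
    rw [Set.mem_preimage, ← seqColimitι_map F h]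
    exact (seqColimitι_injective hF n).mem_set_image

/-- Otherwise there are points `x n` with `g (x n)` outside stage `n`. The tails of the sequence `g
(x n)` are closed, as each stage contains only finitely many of its terms, and compactness of `K`
yields a point whose image lies in all tails. That image lies in some stage `n`, which the `n`-th
tail avoids. -/
theorem exists_range_subset_of_compact
    (hF : ∀ n, IsClosedEmbedding (Hom.toCont (F.map (homOfLE (Nat.le_succ n)))))
    [∀ n, T1Space (F.obj n)] {K : Type*} [TopologicalSpace K] [CompactSpace K]
    (g : C(K, seqColimit F)) : ∃ n, ∀ x, g x ∈ Set.range (Hom.toCont ((seqColimitι F).app n)) := by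
  by_contra! hc
  choose x hx using hc
  have mono : ∀ {m n : ℕ}, m ≤ n → Set.range (Hom.toCont ((seqColimitι F).app m)) ⊆
      Set.range (Hom.toCont ((seqColimitι F).app n)) := by
    rintro m n h _ ⟨y, rfl⟩
    exact ⟨_, seqColimitι_map F h y⟩
  let T : ℕ → Set (seqColimit F) := fun n => (fun k => g (x k)) '' Set.Ici n
  have hT : ∀ n, IsClosed (T n) := fun n => by
    rw [isClosed_seqColimit_iff]
    intro m
    refine Set.Finite.isClosed ?_
    -- Stage `m` contains no `g (x k)` with `k ≥ m`, because the stages increase.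
    refine (((Set.finite_Iio m).image fun k => g (x k)).preimage
      (seqColimitι_injective hF m).injOn).subset ?_
    rintro y ⟨k, -, hk⟩
    refine ⟨k, ?_, hk⟩
    by_contra hmk
    exact hx k (mono (not_lt.1 hmk) ⟨y, hk.symm⟩)
  obtain ⟨y, hy⟩ := IsCompact.nonempty_iInter_of_sequence_nonempty_isCompact_isClosed
    (fun n => g ⁻¹' T n) (fun n => Set.preimage_mono (Set.image_mono
      (Set.Ici_subset_Ici.2 (Nat.le_succ n)))) (fun n => ⟨x n, n, Set.mem_Ici.2 le_rfl, rfl⟩)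
    ((hT 0).preimage g.continuous).isCompact (fun n => (hT n).preimage g.continuous)
  rw [Set.mem_iInter] at hy
  obtain ⟨n, z, hz⟩ := seqColimit_exists_rep F (g y)
  obtain ⟨k, hk, hky⟩ := hy n
  refine hx k (mono hk ⟨z, hz.trans hky.symm⟩)

theorem exists_factor_of_compact
    (hF : ∀ n, IsClosedEmbedding (Hom.toCont (F.map (homOfLE (Nat.le_succ n)))))
    [∀ n, T1Space (F.obj n)] {K : PtdTop.{u}} [CompactSpace K] (g : K ⟶ seqColimit F) :
    ∃ n, ∃ g' : K ⟶ F.obj n, g' ≫ (seqColimitι F).app n = g := by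
  obtain ⟨n, hn⟩ := exists_range_subset_of_compact hF (Hom.toCont g)
  choose g' hg' using hn
  have hι := isClosedEmbedding_seqColimitι hF n
  refine ⟨n, Hom.mk ⟨g', ?_⟩ (hι.injective ?_), hom_ext hg'⟩
  · rw [hι.isInducing.continuous_iff]
    exact (congrArg Continuous (funext hg')).mpr (Hom.toCont g).continuous
  · exact (hg' _).trans ((Hom.map_pt g).trans (Hom.map_pt ((seqColimitι F).app n)).symm)

end Colimit

/-! ### Attaching all cells over a space -/

section Attach

variable (A : PtdTop.{u}) {B X : PtdTop.{u}} (φ : B ⟶ X)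

/-- The attaching maps `Σᵐ A → B` together with an extension over the cone of their composition
with `φ`. -/
def CellOver : Type u :=
  Σ m : ℕ, {p : (iterSusp A m ⟶ B) × (cone (iterSusp A m) ⟶ X) // p.1 ≫ φ = coneIncl _ ≫ p.2}

/-- The cells to be attached. -/
def cells : PtdTop.{u} :=
  wedge₂ (wedge fun _ : (A ⟶ X) => A) (wedge fun α : CellOver A φ => cone (iterSusp A α.1))

/-- The inclusion of the boundaries of the cells. -/
def cellsBoundary : wedge (fun α : CellOver A φ => iterSusp A α.1) ⟶ cells A φ :=
  wedgeMap (fun α : CellOver A φ => coneIncl (iterSusp A α.1)) ≫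
    inr (wedge fun _ : (A ⟶ X) => A) _

/-- The map attaching the cells. -/
def cellsAttach : wedge (fun α : CellOver A φ => iterSusp A α.1) ⟶ B :=
  wedgeDesc fun α => α.2.1.1

/-- The map from the cells to `X`. -/
def cellsMap : cells A φ ⟶ X :=
  desc₂ (wedgeDesc fun s => s) (wedgeDesc fun α => α.2.1.2)

theorem cells_condition : cellsAttach A φ ≫ φ = cellsBoundary A φ ≫ cellsMap A φ := by
  refine wedge_ext fun α => ?_
  exact α.2.2

theorem isClosedEmbedding_cellsBoundary [T1Space A] :
    IsClosedEmbedding (Hom.toCont (cellsBoundary A φ)) :=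
  (isClosedEmbedding_inr _ _).comp
    (isClosedEmbedding_wedgeMap _ fun _ => isClosedEmbedding_coneIncl _)

/-- The space obtained from `B` by attaching all cells over `X`. -/
noncomputable def attach : PtdTop.{u} := glue (cellsAttach A φ) (cellsBoundary A φ)

/-- The inclusion into the space with all cells attached. -/
noncomputable def attachIncl : B ⟶ attach A φ := glueInl _ _

/-- The extension of `φ` to the space with all cells attached. -/
noncomputable def attachMap : attach A φ ⟶ X :=
  glueDesc _ φ (cellsMap A φ) (cells_condition A φ)

variable [T1Space A]

theorem attachesCells_attachIncl : AttachesCells A (attachIncl A φ) :=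
  ⟨(A ⟶ X), CellOver A φ, fun α => α.1, fun α => α.2.1.1, glueInr _
    (isClosedEmbedding_cellsBoundary A φ).injective, isPushout_glue _ _⟩

theorem isClosedEmbedding_attachIncl : IsClosedEmbedding (Hom.toCont (attachIncl A φ)) :=
  isClosedEmbedding_glueInl _ (isClosedEmbedding_cellsBoundary A φ)

instance [T1Space B] : T1Space (attach A φ) :=
  have : T1Space (cells A φ) := inferInstanceAs (T1Space (wedge₂ _ _))
  t1Space_glue _ (isClosedEmbedding_cellsBoundary A φ)

theorem exists_lift_attachMap (s : A ⟶ X) : ∃ s' : A ⟶ attach A φ, s' ≫ attachMap A φ = s :=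
  ⟨wedgeIncl (fun _ : (A ⟶ X) => A) s ≫ inl _ _ ≫
    glueInr _ (isClosedEmbedding_cellsBoundary A φ).injective, rfl⟩

variable {φ} in
theorem exists_cell {m : ℕ} {g : iterSusp A m ⟶ B} {h : cone (iterSusp A m) ⟶ X}
    (hgh : g ≫ φ = coneIncl _ ≫ h) : ∃ k : cone (iterSusp A m) ⟶ attach A φ,
      coneIncl _ ≫ k = g ≫ attachIncl A φ ∧ k ≫ attachMap A φ = h := by
  let α : CellOver A φ := ⟨m, (g, h), hgh⟩
  -- The witness is the characteristic map of the cell indexed by `(g, h)`.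
  refine ⟨wedgeIncl (fun α : CellOver A φ => cone (iterSusp A α.1)) α ≫ inr _ _ ≫
    glueInr _ (isClosedEmbedding_cellsBoundary A φ).injective, ?_, rfl⟩
  exact (congrArg (fun k => wedgeIncl (fun α : CellOver A φ => iterSusp A α.1) α ≫ k)
    (glue_condition (cellsAttach A φ) (isClosedEmbedding_cellsBoundary A φ).injective)).symm

end Attach

/-! ### The approximation -/

section Approximation

variable (A X : PtdTop.{u}) [T1Space A]

/-- A `T₁` space over `X`. -/
structure Stage (X : PtdTop.{u}) where
  space : PtdTop.{u}
  map : space ⟶ X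
  t1 : T1Space space

/-- The stages of the approximation, in each of which all cells over `X` are attached. -/
noncomputable def stage : ℕ → Stage X
  | 0 => ⟨⟨PUnit, PUnit.unit⟩, const _ _, inferInstanceAs (T1Space PUnit)⟩
  | n + 1 =>
    -- The recursion carries the `T₁` property along, since the instance for `attach` requires it of
    -- the base.
    have := (stage n).t1
    ⟨attach A (stage n).map, attachMap A (stage n).map, inferInstance⟩

/-- The sequence of the stages. -/
noncomputable def stageFunctor : ℕ ⥤ PtdTop.{u} :=
  Functor.ofSequence (X := fun n => (stage A X n).space) fun n => attachIncl A (stage A X n).map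

instance (n : ℕ) : T1Space ((stageFunctor A X).obj n) := (stage A X n).t1

theorem stageFunctor_map_succ (n : ℕ) :
    (stageFunctor A X).map (homOfLE (Nat.le_succ n)) = attachIncl A (stage A X n).map :=
  Functor.ofSequence_map_homOfLE_succ _ n

theorem isClosedEmbedding_stageFunctor_map_succ (n : ℕ) :
    IsClosedEmbedding (Hom.toCont ((stageFunctor A X).map (homOfLE (Nat.le_succ n)))) := by
  rw [stageFunctor_map_succ]
  exact isClosedEmbedding_attachIncl A _

/-- The maps from the stages to `X`. -/
noncomputable def stageCocone : Cocone (stageFunctor A X) where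
  pt := X
  ι := NatTrans.ofSequence (fun n => (stage A X n).map) fun n => by
    refine (congrArg (· ≫ (stage A X (n + 1)).map) (stageFunctor_map_succ A X n)).trans ?_
    rfl

/-- The generalized CW(`A`)-complex approximating `X`. -/
noncomputable def approx : PtdTop.{u} := seqColimit (stageFunctor A X)

/-- The map from the approximation to `X`. -/
noncomputable def approxMap : approx A X ⟶ X := (isColimitSeqColimit _).desc (stageCocone A X)

/-- The inclusion of a stage. -/
noncomputable def stageIncl (n : ℕ) : (stage A X n).space ⟶ approx A X :=
  (seqColimitι (stageFunctor A X)).app n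

theorem stageIncl_map (n : ℕ) : stageIncl A X n ≫ approxMap A X = (stage A X n).map :=
  (isColimitSeqColimit _).fac (stageCocone A X) n

/-- The inclusion of the space with all cells attached to a stage. -/
noncomputable def attachStageIncl (n : ℕ) : attach A (stage A X n).map ⟶ approx A X :=
  stageIncl A X (n + 1)

theorem attachIncl_attachStageIncl (n : ℕ) :
    attachIncl A (stage A X n).map ≫ attachStageIncl A X n = stageIncl A X n := by
  rw [← stageFunctor_map_succ]
  exact hom_ext fun x => seqColimitι_map (stageFunctor A X) (Nat.le_succ n) x

theorem isGenCW_approx : IsGenCW A (approx A X) := by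
  refine ⟨stageFunctor A X, seqColimitι _, inferInstanceAs (Subsingleton PUnit), fun n => ?_,
    ⟨isColimitSeqColimit _⟩⟩
  rw [stageFunctor_map_succ]
  exact attachesCells_attachIncl A _

variable {A X} in
-- Pulled back to the cone, `s` extends the constant map. The cell it indexes is attached trivially,
-- so its characteristic map descends to the suspension.
theorem exists_lift_attachMap_susp {m : ℕ} {B : PtdTop.{u}} (φ : B ⟶ X)
    (s : susp (iterSusp A m) ⟶ X) :
    ∃ s' : susp (iterSusp A m) ⟶ attach A φ, s' ≫ attachMap A φ = s := by
  have h : const (iterSusp A m) B ≫ φ = coneIncl _ ≫ coneToSusp _ ≫ s := by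
    rw [← Category.assoc, coneIncl_toSusp, const_comp, const_comp]
  obtain ⟨k, hk, hks⟩ := exists_cell A h
  rw [const_comp] at hk
  obtain ⟨k', rfl⟩ := exists_coneToSusp_comp k hk
  exact ⟨k', coneToSusp_cancel ((Category.assoc _ _ _).symm.trans hks)⟩

theorem exists_lift_approxMap (n : ℕ) (s : iterSusp A n ⟶ X) :
    ∃ s' : iterSusp A n ⟶ approx A X, s' ≫ approxMap A X = s := by
  suffices h : ∃ s' : iterSusp A n ⟶ (stage A X 1).space, s' ≫ (stage A X 1).map = s by
    obtain ⟨s', rfl⟩ := h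
    exact ⟨s' ≫ stageIncl A X 1, by rw [Category.assoc, stageIncl_map]⟩
  cases n with
  | zero => exact exists_lift_attachMap A _ s
  | succ n => exact exists_lift_attachMap_susp _ s

theorem exists_factor_stageIncl {K : PtdTop.{u}} [CompactSpace K] (g : K ⟶ approx A X) :
    ∃ n, ∃ g' : K ⟶ (stage A X n).space, g' ≫ stageIncl A X n = g :=
  exists_factor_of_compact (isClosedEmbedding_stageFunctor_map_succ A X) g

theorem homotopic_const_of_approxMap [CompactSpace A] (m : ℕ) (g : iterSusp A m ⟶ approx A X)
    (hg : Homotopic (g ≫ approxMap A X) (const _ _)) : Homotopic g (const _ _) := by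
  obtain ⟨n, g', rfl⟩ := exists_factor_stageIncl A X g
  rw [Category.assoc, stageIncl_map] at hg
  -- The null-homotopy in `X` indexes a cell of stage `n + 1` with attaching map `g'`; through that
  -- cone `g'` becomes null-homotopic.
  obtain ⟨h, hh⟩ := exists_cone_extension hg
  obtain ⟨k, hk, -⟩ := exists_cell A hh.symm
  have key := (homotopic_coneIncl (iterSusp A m)).postcomp
    (k ≫ attachStageIncl A X n)
  rwa [← Category.assoc, hk, const_comp, Category.assoc, attachIncl_attachStageIncl] at key

theorem IsHCogroup.isAWeakEquiv_approxMap [CompactSpace A] (hA : A.IsHCogroup) :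
    IsAWeakEquiv A (approxMap A X) := by
  intro n
  constructor
  · intro a b
    refine Quotient.inductionOn₂ a b fun g₀ g₁ h => ?_
    exact Quotient.sound (hA.injectiveOfKernel.iterSusp n (approxMap A X)
      (homotopic_const_of_approxMap A X n) g₀ g₁ (Quotient.exact h))
  · intro b
    refine Quotient.inductionOn b fun s => ?_
    obtain ⟨s', rfl⟩ := exists_lift_approxMap A X n s
    exact ⟨Quotient.mk _ s', rfl⟩

end Approximation

end PtdTop

theorem mainTheorem4 (A : PtdTop.{u}) [CompactSpace A] [T1Space A] (hA : A.IsHCogroup)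
    (X : PtdTop.{u}) :
    ∃ (Z : PtdTop.{u}) (f : Z ⟶ X), PtdTop.IsGenCW A Z ∧ PtdTop.IsAWeakEquiv A f :=
  ⟨PtdTop.approx A X, PtdTop.approxMap A X, PtdTop.isGenCW_approx A X,
    hA.isAWeakEquiv_approxMap A X⟩
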